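/- A $2$-graph is a countable small category $\Lambda$ with a functor $d:\Lambda\to\mathbb N^2$ such that whenever $d(\mu)=n+m$ there are unique $\nu,\alpha\in\Lambda$ with $\mu=\nu\alpha$, $d(\nu)=n$, $d(\alpha)=m$; write $\Lambda^n=d^{-1}(n)$. Suppose $\Lambda$ has a single vertex $v$ and every $\Lambda^n$ is finite. An infinite path is a degree-preserving functor $x$ from $\Omega_2=\{(p,q)\in\mathbb N^2\times\mathbb N^2:p\le q\}$ (with $d(p,q)=q-p$) to $\Lambda$; $\Lambda^\infty$ is the set of infinite paths, $\sigma^n(x)(p,q)=x(n+p,n+q)$, and $\mu x$ is the infinite path with $(\mu x)(0,d(\mu))=\mu$ and $\sigma^{d(\mu)}(\mu x)=x$. $\Lambda$ is periodic if there is no $x\in\Lambda^\infty$ with $\sigma^n(x)\ne\sigma^m(x)$ for all $n\neq m$. Put $\mathrm{Per}(\Lambda)=\{d(\mu)-d(\nu): \mu x=\nu x \text{ for all } x\in\Lambda^\infty\}\subset\mathbb Z^2$. $C^*(\Lambda)$ is the $C^*$-algebra generated by a universal family $\{s_\mu\}_{\mu\in\Lambda}$ such that $s_v$ is a projection, $s_{\mu\nu}=s_\mu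 s_\nu$, $s_\mu^*s_\mu=s_v$ and $s_v=\sum_{\mu\in\Lambda^n}s_\mu s_\mu^*$ for all $\mu,\nu\in\Lambda$, $n\in\mathbb N^2$; its unit is $s_v$. **Lemma.** Let $\Lambda$ be a periodic single-vertex $2$-graph with finite sets $\Lambda^n$ and with $|\Lambda^{e_1}|,|\Lambda^{e_2}|\ge 2$. Then there are positive integers $a,b$ with $\mathrm{Per}(\Lambda)=\mathbb Z(a,-b)$ and a bijection $h:\Lambda^{ae_1}\to\Lambda^{be_2}$ with $\mu\nu=h(\mu)h^{-1}(\nu)$ for all $\mu\in\Lambda^{ae_1}$, $\nu\in\Lambda^{be_2}$. For any such $a,b,h$, the element $$W=\sum_{\mu\in\Lambda^{ae_1}}s_{h(\mu)}s_\mu^*\in C^*(\Lambda)$$ is unitary, its spectrum contains the unit circle $\mathbb T$, and there is a $*$-isomorphism from $C^*(W)$ onto $C(\mathbb T)$ that sends $W$ to the identity function $z\mapsto z$. -/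

import Mathlib

open CategoryTheory

universe u

/-- A countable small category `Λ` with a degree functor to `ℕ^k` is a `k`-graph if it has the
unique factorization property. A path `μ` with source `v` and range `w` is a morphism `v ⟶ w`, so
the composite path written `μν` (first `ν`, then `μ`; defined when `s(μ) = r(ν)`) is `ν ≫ μ`. -/
class KGraph (k : outParam ℕ) (Λ : Type u) [SmallCategory Λ] where
  countable_vertices : Countable Λ
  countable_paths : ∀ v w : Λ, Countable (v ⟶ w)
  /-- The degree map. -/
  deg : ∀ {v w : Λ}, (v ⟶ w) → (Fin k → ℕ)
  deg_id : ∀ v : Λ, deg (𝟙 v) = 0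
  deg_comp : ∀ {t v w : Λ} (ν : t ⟶ v) (μ : v ⟶ w), deg (ν ≫ μ) = deg μ + deg ν
  factorization : ∀ {v w : Λ} (μ : v ⟶ w) (n m : Fin k → ℕ), deg μ = n + m →
    ∃! p : (t : Λ) × (t ⟶ w) × (v ⟶ t),
      deg p.2.1 = n ∧ deg p.2.2 = m ∧ p.2.2 ≫ p.2.1 = μ

namespace KGraph

variable {k : ℕ} (Λ : Type u) [SmallCategory Λ] [KGraph k Λ]

/-- The set `vΛ^n` of paths of degree `n` with range `v`. -/
abbrev PathsTo {k : ℕ} {Λ : Type u} [SmallCategory Λ] [KGraph k Λ] (v : Λ) (n : Fin k → ℕ) :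
    Type u :=
  {p : (t : Λ) × (t ⟶ v) // deg p.2 = n}

/-- `Λ` is row-finite if every `vΛ^n` is finite. -/
class RowFinite : Prop where
  finite_pathsTo : ∀ (v : Λ) (n : Fin k → ℕ), Finite (PathsTo v n)

noncomputable instance [RowFinite Λ] (v : Λ) (n : Fin k → ℕ) : Fintype (PathsTo v n) :=
  @Fintype.ofFinite _ (RowFinite.finite_pathsTo v n)

/-! ### Infinite paths, periodicity -/

/-- An infinite path: a degree-preserving functor to `Λ` from the category `Ω_k` of pairs `(m, n)`
with `m ≤ n` in `ℕ^k`, where `(m, n)` has range `m`, source `n` and degree `n - m`, and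
`(l, m)(m, n) = (l, n)`. The path `x(m, n)` is `x.seg h` for `h : m ≤ n`. -/
@[ext]
structure InfinitePath where
  obj : (Fin k → ℕ) → Λ
  seg : ∀ {m n : Fin k → ℕ}, m ≤ n → (obj n ⟶ obj m)
  seg_refl : ∀ m : Fin k → ℕ, seg (le_refl m) = 𝟙 (obj m)
  seg_comp : ∀ {l m n : Fin k → ℕ} (hlm : l ≤ m) (hmn : m ≤ n),
    seg hmn ≫ seg hlm = seg (hlm.trans hmn)
  deg_seg : ∀ {m n : Fin k → ℕ} (h : m ≤ n), deg (seg h) = n - m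

variable {Λ}

namespace InfinitePath

/-- The range `x(0)` of an infinite path. -/
def range (x : InfinitePath Λ) : Λ := x.obj 0

/-- The initial segment `x(0, n)`. -/
def initial (x : InfinitePath Λ) (n : Fin k → ℕ) : x.obj n ⟶ x.obj 0 := x.seg zero_le

/-- The shifted path `σ^p(x)`, with `σ^p(x)(m, n) = x(p + m, p + n)`. -/
def shift (p : Fin k → ℕ) (x : InfinitePath Λ) : InfinitePath Λ where
  obj n := x.obj (p + n)
  seg h := x.seg (add_le_add_right h p)
  seg_refl _ := x.seg_refl _
  seg_comp _ _ := x.seg_comp _ _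
  deg_seg {m n} h := (x.deg_seg (add_le_add_right h p)).trans (add_tsub_add_eq_tsub_left p n m)

/-- `y = μx`: the infinite path `y` starts with `μ` and continues with `x`. -/
def IsConcat {v w : Λ} (μ : v ⟶ w) (x y : InfinitePath Λ) : Prop :=
  Arrow.mk (y.initial (deg μ)) = Arrow.mk μ ∧ y.shift (deg μ) = x

end InfinitePath

/-- `(μ, ν)` is a cycline pair: `s(μ) = s(ν)` and `μx = νx` for all `x ∈ s(μ)Λ^∞`. -/
def IsCycline {v w w' : Λ} (μ : v ⟶ w) (ν : v ⟶ w') : Prop :=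
  ∀ x : InfinitePath Λ, x.range = v → ∃ y, x.IsConcat μ y ∧ x.IsConcat ν y

variable (Λ)

/-- `Per(Λ)`: the set of all `d(μ) - d(ν)` with `(μ, ν)` a cycline pair. -/
def Per : Set (Fin k → ℤ) :=
  {g | ∃ (v w w' : Λ) (μ : v ⟶ w) (ν : v ⟶ w'), IsCycline μ ν ∧
    g = fun i => (deg μ i : ℤ) - (deg ν i : ℤ)}

/-- Every vertex is the range of an infinite path whose shifts are pairwise distinct. -/
def IsAperiodic : Prop :=
  ∀ v : Λ, ∃ x : InfinitePath Λ, x.range = v ∧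
    ∀ n m : Fin k → ℕ, n ≠ m → x.shift n ≠ x.shift m

/-- `Λ` is periodic if it is not aperiodic. -/
def IsPeriodic : Prop := ¬ IsAperiodic Λ

/-! ### Cuntz–Krieger families and the C*-algebra -/

section CStar

variable [RowFinite Λ]

/-- Cuntz–Krieger `Λ`-families, for a row-finite `k`-graph without sources, in a C*-algebra `B`;
`S_v` is `S (𝟙 v)`. Since `S_μ^* S_μ` is a projection, each `S_μ` is a partial isometry. -/
structure IsCKFamily {k : ℕ} {Λ : Type u} [SmallCategory Λ] [KGraph k Λ] [RowFinite Λ] {B : Type*}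
    [NonUnitalCStarAlgebra B] (S : ∀ ⦃v w : Λ⦄, (v ⟶ w) → B) : Prop where
  isStarProjection : ∀ v : Λ, IsStarProjection (S (𝟙 v))
  orthogonal : ∀ v w : Λ, v ≠ w → S (𝟙 v) * S (𝟙 w) = 0
  map_comp : ∀ {t v w : Λ} (μ : v ⟶ w) (ν : t ⟶ v), S (ν ≫ μ) = S μ * S ν
  star_mul_self : ∀ {v w : Λ} (μ : v ⟶ w), star (S μ) * S μ = S (𝟙 v)
  sum_mul_star : ∀ (v : Λ) (n : Fin k → ℕ),
    S (𝟙 v) = ∑ p : PathsTo v n, S p.1.2 * star (S p.1.2)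

theorem IsCKFamily.norm_le_one {B : Type*} [NonUnitalCStarAlgebra B]
    {S : ∀ ⦃v w : Λ⦄, (v ⟶ w) → B} (hS : IsCKFamily S) {v w : Λ} (μ : v ⟶ w) : ‖S μ‖ ≤ 1 := by
  have key : ∀ a b : B, ‖star a * a‖ = ‖b‖ → ‖b‖ ≤ 1 → ‖a‖ ≤ 1 := by
    intro a b h hb
    rw [CStarRing.norm_star_mul_self] at h
    nlinarith [norm_nonneg a]
  have hp : ‖S (𝟙 v)‖ ≤ 1 := by
    have h := hS.isStarProjection v
    have h2 : star (S (𝟙 v)) * S (𝟙 v) = S (𝟙 v) := by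
      rw [h.isSelfAdjoint.star_eq, h.isIdempotentElem.eq]
    have h3 := CStarRing.norm_star_mul_self (x := S (𝟙 v))
    rw [h2] at h3
    nlinarith [norm_nonneg (S (𝟙 v))]
  exact key _ _ (by rw [hS.star_mul_self]) hp

/-- A Cuntz–Krieger `Λ`-family together with the C*-algebra in which it lives. (A C*-algebra
generated by a Cuntz–Krieger `Λ`-family is separable, since `Λ` is countable, so it has an
isomorphic copy in every universe.) -/
structure CKRep : Type (u + 1) where
  carrier : Type u
  [cstar : NonUnitalCStarAlgebra carrier]
  S : ∀ ⦃v w : Λ⦄, (v ⟶ w) → carrier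
  isCKFamily : IsCKFamily S

attribute [instance] CKRep.cstar

/-- The direct sum of all Cuntz–Krieger `Λ`-families, in the `ℓ^∞`-product of the C*-algebras. -/
noncomputable def sumFamily ⦃v w : Λ⦄ (μ : v ⟶ w) : lp (fun i : CKRep Λ => i.carrier) ⊤ :=
  ⟨fun i => i.S μ, memℓp_infty ⟨1, by
    rintro _ ⟨i, rfl⟩
    exact i.isCKFamily.norm_le_one Λ μ⟩⟩

/-- The C*-subalgebra generated by the direct sum of all Cuntz–Krieger families. -/
noncomputable def universalSubalgebra :
    NonUnitalStarSubalgebra ℂ (lp (fun i : CKRep Λ => i.carrier) ⊤) :=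
  (NonUnitalStarAlgebra.adjoin ℂ
    {x | ∃ (v w : Λ) (μ : v ⟶ w), x = sumFamily Λ μ}).topologicalClosure

instance : IsClosed (universalSubalgebra Λ : Set (lp (fun i : CKRep Λ => i.carrier) ⊤)) :=
  NonUnitalStarSubalgebra.isClosed_topologicalClosure _

/-- The `k`-graph C*-algebra `C*(Λ)` of a row-finite `k`-graph without sources: the C*-algebra
generated by a universal Cuntz–Krieger `Λ`-family. -/
def GraphCStar : Type (u + 1) := universalSubalgebra Λ

noncomputable instance : NonUnitalCStarAlgebra (GraphCStar Λ) :=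
  inferInstanceAs (NonUnitalCStarAlgebra (universalSubalgebra Λ))

variable {Λ}

/-- The universal Cuntz–Krieger family `s_μ` in `C*(Λ)`. -/
noncomputable def gen ⦃v w : Λ⦄ (μ : v ⟶ w) : GraphCStar Λ :=
  ⟨sumFamily Λ μ, NonUnitalStarSubalgebra.le_topologicalClosure _
    (NonUnitalStarAlgebra.subset_adjoin ℂ _ ⟨v, w, μ, rfl⟩)⟩

theorem gen_isCKFamily : IsCKFamily (gen (Λ := Λ)) := by
  have ext : ∀ a b : GraphCStar Λ, (∀ i, a.1 i = b.1 i) → a = b := fun a b h =>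
    Subtype.ext (lp.ext (funext h))
  refine ⟨fun v => ⟨?_, ?_⟩, fun v w h => ?_, fun μ ν => ?_, fun μ => ?_, fun v n => ?_⟩
  · exact ext _ _ fun i => (i.isCKFamily.isStarProjection v).isIdempotentElem.eq
  · exact ext _ _ fun i => (i.isCKFamily.isStarProjection v).isSelfAdjoint.star_eq
  · exact ext _ _ fun i => i.isCKFamily.orthogonal v w h
  · exact ext _ _ fun i => i.isCKFamily.map_comp μ ν
  · exact ext _ _ fun i => i.isCKFamily.star_mul_self μ
  · refine ext _ _ fun i => ?_
    refine (i.isCKFamily.sum_mul_star v n).trans ?_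
    let φ : GraphCStar Λ →+ i.carrier :=
      { toFun := fun a => a.1 i, map_zero' := rfl, map_add' := fun _ _ => rfl }
    exact (map_sum φ (fun p : PathsTo v n => gen p.1.2 * star (gen p.1.2)) Finset.univ).symm

theorem induction_closure {P : GraphCStar Λ → Prop} (hcl : IsClosed {a | P a})
    (hgen : ∀ {v w : Λ} (μ : v ⟶ w), P (gen μ)) (hzero : P 0)
    (hadd : ∀ a b, P a → P b → P (a + b)) (hmul : ∀ a b, P a → P b → P (a * b))
    (hsmul : ∀ (c : ℂ) a, P a → P (c • a)) (hstar : ∀ a, P a → P (star a))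
    (a : GraphCStar Λ) : P a := by
  have hsub : ∀ x (hx : x ∈ NonUnitalStarAlgebra.adjoin ℂ
      {x | ∃ (v w : Λ) (μ : v ⟶ w), x = sumFamily Λ μ}),
      P ⟨x, NonUnitalStarSubalgebra.le_topologicalClosure _ hx⟩ := by
    intro x hx
    induction hx using NonUnitalStarAlgebra.adjoin_induction with
    | mem x hx => obtain ⟨v, w, μ, rfl⟩ := hx; exact hgen μ
    | add x y hx hy h1 h2 => exact hadd _ _ h1 h2
    | zero => exact hzero
    | mul x y hx hy h1 h2 => exact hmul _ _ h1 h2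
    | smul r x hx h => exact hsmul r _ h
    | star x hx h => exact hstar _ h
  have hdense : Dense {a : GraphCStar Λ | P a} := by
    intro a
    refine Metric.mem_closure_iff.2 fun ε hε => ?_
    obtain ⟨b, hb, hab⟩ := Metric.mem_closure_iff.1 a.2 ε hε
    exact ⟨⟨b, NonUnitalStarSubalgebra.le_topologicalClosure _ hb⟩, hsub b hb, hab⟩
  exact hcl.closure_subset (hdense a)

/-- The universal property of `C*(Λ)`. -/
theorem existsUnique_hom {B : Type u} [NonUnitalCStarAlgebra B]
    (S : ∀ ⦃v w : Λ⦄, (v ⟶ w) → B) (hS : IsCKFamily S) :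
    ∃! φ : GraphCStar Λ →⋆ₙₐ[ℂ] B, ∀ {v w : Λ} (μ : v ⟶ w), φ (gen μ) = S μ := by
  let i : CKRep Λ := ⟨B, S, hS⟩
  refine ⟨{ toFun := fun a => a.1 i
            map_zero' := rfl
            map_add' := fun _ _ => rfl
            map_mul' := fun _ _ => rfl
            map_smul' := fun _ _ => rfl
            map_star' := fun _ => rfl }, fun _ => rfl, fun ψ hψ => ?_⟩
  ext a
  have hψc : Continuous ψ :=
    AddMonoidHomClass.continuous_of_bound ψ 1 fun x => by
      simpa using NonUnitalStarAlgHom.norm_apply_le ψ x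
  refine induction_closure (P := fun a => ψ a = a.1 i) ?_ (fun μ => hψ μ) (map_zero ψ)
    (fun a b ha hb => by rw [map_add, ha, hb]; rfl)
    (fun a b ha hb => by rw [map_mul, ha, hb]; rfl)
    (fun c a ha => by rw [map_smul, ha]; rfl)
    (fun a ha => by rw [map_star, ha]; rfl) a
  refine isClosed_eq hψc ?_
  exact (lp.lipschitzWith_one_eval (E := fun i : CKRep Λ => i.carrier) ⊤ i).continuous.comp
    continuous_subtype_val

/-- If `Λ` has only one vertex `v`, then `s_v` is a unit of `C*(Λ)`. -/
theorem gen_id_mul_and_mul_gen_id [Unique Λ] (a : GraphCStar Λ) :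
    gen (𝟙 (default : Λ)) * a = a ∧ a * gen (𝟙 (default : Λ)) = a := by
  have hs : star (gen (𝟙 (default : Λ))) = gen (𝟙 (default : Λ)) :=
    (gen_isCKFamily.isStarProjection _).isSelfAdjoint.star_eq
  refine induction_closure (P := fun a => gen (𝟙 (default : Λ)) * a = a ∧
    a * gen (𝟙 (default : Λ)) = a) ?_ ?_ ⟨mul_zero _, zero_mul _⟩ ?_ ?_ ?_ ?_ a
  · exact (isClosed_eq (continuous_const.mul continuous_id) continuous_id).inter
      (isClosed_eq (continuous_id.mul continuous_const) continuous_id)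
  · intro v w μ
    obtain rfl := Subsingleton.elim v default
    obtain rfl := Subsingleton.elim w default
    exact ⟨by rw [← gen_isCKFamily.map_comp, Category.comp_id],
      by rw [← gen_isCKFamily.map_comp, Category.id_comp]⟩
  · rintro a b ⟨h1, h2⟩ ⟨h3, h4⟩
    exact ⟨by rw [mul_add, h1, h3], by rw [add_mul, h2, h4]⟩
  · rintro a b ⟨h1, h2⟩ ⟨h3, h4⟩
    exact ⟨by rw [← mul_assoc, h1], by rw [mul_assoc, h4]⟩
  · rintro c a ⟨h1, h2⟩
    exact ⟨by rw [mul_smul_comm, h1], by rw [smul_mul_assoc, h2]⟩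
  · rintro a ⟨h1, h2⟩
    constructor
    · rw [← hs, ← star_mul, h2]
    · rw [← hs, ← star_mul, h1]

/-- If `Λ` has only one vertex `v`, then `C*(Λ)` is a unital C*-algebra with unit `s_v`. -/
noncomputable instance [Unique Λ] : CStarAlgebra (GraphCStar Λ) :=
  letI ring : NormedRing (GraphCStar Λ) :=
    { (inferInstance : NonUnitalNormedRing (GraphCStar Λ)) with
      one := gen (𝟙 (default : Λ))
      one_mul := fun a => (gen_id_mul_and_mul_gen_id a).1
      mul_one := fun a => (gen_id_mul_and_mul_gen_id a).2 }
  letI alg : Algebra ℂ (GraphCStar Λ) := Algebra.ofModule smul_mul_assoc mul_smul_comm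
  { ring, (inferInstance : NonUnitalCStarAlgebra (GraphCStar Λ)) with
    toAlgebra := alg }

end CStar

/-! ### The distinguished unitary of a periodic single-vertex `2`-graph -/

section SingleVertex

variable [Unique Λ]

/-- For a single-vertex `Λ`, the set `Λ^n` of paths of degree `n`. -/
abbrev PathsOfDegree {k : ℕ} (Λ : Type u) [SmallCategory Λ] [KGraph k Λ] [Unique Λ]
    (n : Fin k → ℕ) : Type u :=
  {μ : (default : Λ) ⟶ default // deg μ = n}

noncomputable instance [RowFinite Λ] (n : Fin k → ℕ) : Fintype (PathsOfDegree Λ n) :=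
  haveI := RowFinite.finite_pathsTo (default : Λ) n
  @Fintype.ofFinite _ (Finite.of_injective
    (fun μ => (⟨⟨default, μ.1⟩, μ.2⟩ : PathsTo (default : Λ) n)) fun μ ν h => by
      have := congrArg Subtype.val h
      simp only [Sigma.mk.injEq, heq_eq_eq, true_and] at this
      exact Subtype.ext this)

/-- The data `(a, b, h)` attached to a single-vertex `2`-graph: `a, b` are positive integers such
that `(a, -b)` generates `Per(Λ)`, and `h` is a bijection from the paths that are products of `a`
edges of degree `e₁` to the paths that are products of `b` edges of degree `e₂` (that is, by unique
factorization, from `Λ^{a e₁}` to `Λ^{b e₂}`) with `μν = h(μ) h⁻¹(ν)`. -/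
structure IsPeriodData {Λ : Type u} [SmallCategory Λ] [KGraph 2 Λ] [Unique Λ] (a b : ℕ)
    (h : PathsOfDegree Λ ![a, 0] ≃ PathsOfDegree Λ ![0, b]) : Prop where
  pos_left : 0 < a
  pos_right : 0 < b
  per_eq : Per Λ = {g | ∃ n : ℤ, g = n • ![(a : ℤ), -(b : ℤ)]}
  comp_eq : ∀ (μ : PathsOfDegree Λ ![a, 0]) (ν : PathsOfDegree Λ ![0, b]),
    ν.1 ≫ μ.1 = (h.symm ν).1 ≫ (h μ).1

/-- The element `W = ∑_μ s_{h(μ)} s_μ^*` of `C*(Λ)`. -/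
noncomputable def distinguishedW {Λ : Type u} [SmallCategory Λ] [KGraph 2 Λ] [RowFinite Λ]
    [Unique Λ] {a b : ℕ} (h : PathsOfDegree Λ ![a, 0] ≃ PathsOfDegree Λ ![0, b]) :
    GraphCStar Λ :=
  ∑ μ : PathsOfDegree Λ ![a, 0], gen (h μ).1 * star (gen μ.1)

end SingleVertex

end KGraph

/-! With a single vertex the paths form a graded left-cancellative monoid. There `μ ∣ l` says that
`μ` is a prefix of `l`, and an infinite path is a coherent family of prefixes.

Periodicity yields `n ≠ m` with `σ^n = σ^m` on all infinite paths (`IsPeriodic.exists_shiftEq`):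
otherwise a Baire-type construction produces one path whose shifts are all distinct. The differences
`n - m` of such pairs are exactly `Per Λ`, which is a group. Two edges of each colour exclude
nonzero periods with both coordinates nonnegative (`Per_nonneg_eq_zero`). Hence the first coordinate
is injective on `Per Λ`, the group is cyclic, and its generator has coordinates of opposite signs
(`exists_Per_eq_multiples`). If `σ^n = σ^m`, each path of degree `n` acts on infinite paths as
exactly one path of degree `m`; for `n = (a, 0)` and `m = (0, b)` this correspondence is `h`.

The element `W` matches two families of isometries whose range projections sum to `1`, so it is
unitary. Representations on `ℓ²(Λ^∞)` twisted by the first degree coordinate send `W` to every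
unimodular multiple of one fixed operator. Its spectrum is nonempty and lies on the circle, so its
rotations, all contained in the spectrum of `W`, fill the circle. The continuous functional calculus
then gives the isomorphism. -/

namespace KGraph

/-! ### Paths and infinite paths in a graph with one vertex -/

section PathMonoid

variable {k : ℕ} {Λ : Type u} [SmallCategory Λ] [KGraph k Λ] [Unique Λ]

theorem deg_one : deg (1 : End (default : Λ)) = 0 := deg_id _

theorem deg_mul (μ ν : End (default : Λ)) : deg (μ * ν : End (default : Λ)) = deg μ + deg ν :=
  deg_comp ν μ

theorem factor_unique {μ ν μ' ν' : End (default : Λ)} (h : μ * ν = μ' * ν')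
    (hd : deg μ = deg μ') : μ = μ' ∧ ν = ν' := by
  have hd' : deg ν = deg ν' := by
    have := congrArg (fun l : End (default : Λ) => deg (k := k) l) h
    simp only [deg_mul, hd] at this
    exact add_left_cancel this
  have := (factorization (μ * ν : End (default : Λ)) (deg μ) (deg ν) (deg_mul μ ν)).unique
    (y₁ := ⟨default, μ, ν⟩) (y₂ := ⟨default, μ', ν'⟩) ⟨rfl, rfl, rfl⟩ ⟨hd.symm, hd'.symm, h.symm⟩
  simp only [Sigma.mk.injEq, heq_eq_eq, Prod.mk.injEq, true_and] at this
  exact this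

theorem mul_left_cancel_path {k : ℕ} {Λ : Type u} [SmallCategory Λ] [KGraph k Λ] [Unique Λ]
    {μ ν ν' : End (default : Λ)} (h : μ * ν = μ * ν') : ν = ν' :=
  (factor_unique h rfl).2

theorem exists_factor (l : End (default : Λ)) {n m : Fin k → ℕ} (h : deg l = n + m) :
    ∃ μ ν : End (default : Λ), deg μ = n ∧ deg ν = m ∧ μ * ν = l := by
  obtain ⟨⟨t, μ, ν⟩, ⟨h1, h2, h3⟩, -⟩ := factorization l n m h
  obtain rfl := Subsingleton.elim t default
  exact ⟨μ, ν, h1, h2, h3⟩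

theorem exists_prefix (l : End (default : Λ)) {n : Fin k → ℕ} (h : n ≤ deg l) :
    ∃ μ : End (default : Λ), μ ∣ l ∧ deg μ = n := by
  obtain ⟨μ, ν, h1, -, h3⟩ := exists_factor l (add_tsub_cancel_of_le h).symm
  exact ⟨μ, ⟨ν, h3.symm⟩, h1⟩

theorem prefix_unique {μ ν l : End (default : Λ)} (h1 : μ ∣ l) (h2 : ν ∣ l)
    (hd : deg μ = deg ν) : μ = ν := by
  obtain ⟨α, rfl⟩ := h1
  obtain ⟨β, h⟩ := h2
  exact (factor_unique h hd).1

theorem prefix_of_le {μ ν l : End (default : Λ)} (h1 : μ ∣ l) (h2 : ν ∣ l)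
    (hd : deg μ ≤ deg ν) : μ ∣ ν := by
  obtain ⟨μ', h, h'⟩ := exists_prefix ν hd
  rwa [prefix_unique h1 (h.trans h2) h'.symm]

/-- A morphism of a one-vertex category as an endomorphism of its vertex. -/
def toEnd {v w : Λ} (f : v ⟶ w) : End (default : Λ) :=
  eqToHom (Subsingleton.elim _ _) ≫ f ≫ eqToHom (Subsingleton.elim _ _)

theorem toEnd_eq (f : (default : Λ) ⟶ default) : toEnd f = f := by simp [toEnd]

theorem arrow_mk_toEnd {v w : Λ} (f : v ⟶ w) :
    Arrow.mk (toEnd f : (default : Λ) ⟶ default) = Arrow.mk f := by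
  obtain rfl := Subsingleton.elim v default
  obtain rfl := Subsingleton.elim w default
  rw [toEnd_eq]

theorem deg_toEnd {v w : Λ} (f : v ⟶ w) : deg (toEnd f) = deg f := by
  obtain rfl := Subsingleton.elim v default
  obtain rfl := Subsingleton.elim w default
  rw [toEnd_eq]

theorem toEnd_comp {t v w : Λ} (f : t ⟶ v) (g : v ⟶ w) : toEnd (f ≫ g) = toEnd g * toEnd f := by
  obtain rfl := Subsingleton.elim v default
  obtain rfl := Subsingleton.elim w default
  obtain rfl := Subsingleton.elim t default
  simp only [toEnd_eq]; rfl

theorem toEnd_injective {v w : Λ} {f g : v ⟶ w} (h : toEnd f = toEnd g) : f = g := by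
  obtain rfl := Subsingleton.elim v default
  obtain rfl := Subsingleton.elim w default
  simpa only [toEnd_eq] using h

/-! ### Infinite paths as coherent families of prefixes -/

namespace InfinitePath

/-- The initial segment of degree `n`, as an endomorphism of the vertex. -/
def pre (x : InfinitePath Λ) (n : Fin k → ℕ) : End (default : Λ) := toEnd (x.initial n)

theorem deg_pre (x : InfinitePath Λ) (n : Fin k → ℕ) : deg (x.pre n) = n := by
  rw [pre, deg_toEnd, initial, x.deg_seg, tsub_zero]

theorem pre_mul_seg (x : InfinitePath Λ) {m n : Fin k → ℕ} (h : m ≤ n) :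
    x.pre m * toEnd (x.seg h) = x.pre n := by
  rw [pre, ← toEnd_comp, initial, x.seg_comp]; rfl

theorem pre_dvd (x : InfinitePath Λ) {m n : Fin k → ℕ} (h : m ≤ n) : x.pre m ∣ x.pre n :=
  ⟨_, (x.pre_mul_seg h).symm⟩

theorem pre_mul_pre_shift (x : InfinitePath Λ) (p n : Fin k → ℕ) :
    x.pre p * (x.shift p).pre n = x.pre (p + n) :=
  -- The initial segment of `x.shift p` unfolds to the segment of `x` from `p + 0` to `p + n`.
  x.pre_mul_seg (m := p + 0) (n := p + n) (add_le_add_right (zero_le (a := n)) p)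

theorem pre_injective {x y : InfinitePath Λ} (h : ∀ n, x.pre n = y.pre n) : x = y := by
  have hseg : ∀ {m n : Fin k → ℕ} (hmn : m ≤ n), toEnd (x.seg hmn) = toEnd (y.seg hmn) := by
    intro m n hmn
    apply mul_left_cancel_path (μ := x.pre m)
    rw [pre_mul_seg, h m, pre_mul_seg, h n]
  obtain ⟨xo, xs, _, _, _⟩ := x
  obtain ⟨yo, ys, _, _, _⟩ := y
  obtain rfl : xo = fun _ => default := funext fun _ => Subsingleton.elim _ _
  obtain rfl : yo = fun _ => default := funext fun _ => Subsingleton.elim _ _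
  congr
  funext m n hmn
  exact toEnd_injective (hseg hmn)

theorem pre_injective_of_le {x y : InfinitePath Λ} (h : ∀ n, ∃ m, n ≤ m ∧ x.pre m = y.pre m) :
    x = y := by
  refine pre_injective fun n => ?_
  obtain ⟨m, hnm, hm⟩ := h n
  exact prefix_unique (x.pre_dvd hnm) (hm ▸ y.pre_dvd hnm) (by simp only [deg_pre])

/-- The segments are the quotients `f m \ f n`; left cancellation makes them unique and therefore
functorial. -/
theorem exists_of_pre (f : (Fin k → ℕ) → End (default : Λ)) (hdeg : ∀ n, deg (f n) = n)
    (hdvd : ∀ m n, m ≤ n → f m ∣ f n) : ∃ x : InfinitePath Λ, ∀ n, x.pre n = f n := by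
  choose g hg using hdvd
  have hg0 : ∀ n (h : 0 ≤ n), g 0 n h = f n := by
    intro n h
    have h0 : f 0 = 1 := by
      refine (factor_unique (μ := f 0) (ν := 1) (μ' := 1) (ν' := f 0) ?_ ?_).1
      · rw [mul_one, one_mul]
      · rw [hdeg, deg_one]
    have := hg 0 n h
    rw [h0, one_mul] at this
    exact this.symm
  refine ⟨{ obj := fun _ => default
            seg := fun {m n} h => g m n h
            seg_refl := fun m => ?_
            seg_comp := fun {l m n} hlm hmn => ?_
            deg_seg := fun {m n} h => ?_ }, fun n => ?_⟩
  · refine mul_left_cancel_path (μ := f m) (ν := g m m le_rfl) (ν' := 1) ?_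
    rw [← hg, mul_one]
  · refine mul_left_cancel_path (μ := f l) (ν := g l m hlm * g m n hmn)
      (ν' := g l n (hlm.trans hmn)) ?_
    rw [← hg, ← mul_assoc, ← hg, ← hg]
  · have := congrArg (fun l : End (default : Λ) => deg (k := k) l) (hg m n h)
    simp only [deg_mul, hdeg] at this
    exact (eq_tsub_of_add_eq ((add_comm _ _).trans this.symm))
  · exact (toEnd_eq _).trans (hg0 n _)

/-- The prefix of degree `n` is read off from any member of the family of degree at least `n`;
directedness makes the choice irrelevant. -/
theorem exists_of_directed {ι : Type*} (f : ι → End (default : Λ)) (hdir : Directed (· ∣ ·) f)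
    (hcof : ∀ n, ∃ i, n ≤ deg (f i)) : ∃ x : InfinitePath Λ, ∀ i, x.pre (deg (f i)) = f i := by
  choose i hi using hcof
  have h1 := fun n => exists_prefix (f (i n)) (hi n)
  choose g hg hgd using h1
  have key : ∀ n j, n ≤ deg (f j) → g n ∣ f j := by
    intro n j hj
    obtain ⟨l, hl1, hl2⟩ := hdir (i n) j
    exact prefix_of_le ((hg n).trans hl1) hl2 (by rwa [hgd])
  obtain ⟨x, hx⟩ := exists_of_pre g hgd fun m n h =>
    prefix_of_le (key m (i n) (h.trans (hi n))) (hg n) (by rwa [hgd, hgd])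
  exact ⟨x, fun j => by rw [hx]; exact prefix_unique (key _ j le_rfl) (dvd_refl _) (hgd _)⟩

theorem exists_concat (μ : End (default : Λ)) (x : InfinitePath Λ) :
    ∃ y : InfinitePath Λ, y.pre (deg μ) = μ ∧ y.shift (deg μ) = x := by
  obtain ⟨y, hy⟩ := exists_of_directed (fun n => μ * x.pre n)
    (fun m n => ⟨m ⊔ n, mul_dvd_mul_left μ (x.pre_dvd le_sup_left),
      mul_dvd_mul_left μ (x.pre_dvd le_sup_right)⟩)
    (fun n => ⟨n, by rw [deg_mul, deg_pre]; exact le_add_self⟩)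
  simp only [deg_mul, deg_pre] at hy
  have h0 : y.pre (deg μ) = μ := prefix_unique (l := y.pre (deg μ + 0))
    (y.pre_dvd le_self_add) ⟨_, hy 0⟩ (deg_pre _ _)
  refine ⟨y, h0, pre_injective fun n => mul_left_cancel_path (μ := μ) ?_⟩
  rw [← hy n, ← pre_mul_pre_shift, h0]

/-- The infinite path `μx`. -/
noncomputable def concat (μ : End (default : Λ)) (x : InfinitePath Λ) : InfinitePath Λ :=
  (exists_concat μ x).choose

theorem pre_concat (μ : End (default : Λ)) (x : InfinitePath Λ) : (concat μ x).pre (deg μ) = μ :=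
  (exists_concat μ x).choose_spec.1

theorem shift_concat (μ : End (default : Λ)) (x : InfinitePath Λ) :
    (concat μ x).shift (deg μ) = x :=
  (exists_concat μ x).choose_spec.2

theorem pre_concat_add (μ : End (default : Λ)) (x : InfinitePath Λ) (n : Fin k → ℕ) :
    (concat μ x).pre (deg μ + n) = μ * x.pre n := by
  rw [← pre_mul_pre_shift, pre_concat, shift_concat]

theorem eq_concat {μ : End (default : Λ)} {x y : InfinitePath Λ} (h1 : y.pre (deg μ) = μ)
    (h2 : y.shift (deg μ) = x) : y = concat μ x :=
  pre_injective_of_le fun n => ⟨deg μ + n, le_add_self, by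
    rw [pre_concat_add, ← pre_mul_pre_shift, h1, h2]⟩

theorem concat_pre_shift (x : InfinitePath Λ) (n : Fin k → ℕ) :
    concat (x.pre n) (x.shift n) = x :=
  (eq_concat (by rw [deg_pre]) (by rw [deg_pre])).symm

theorem isConcat_iff {μ : End (default : Λ)} {x y : InfinitePath Λ} :
    IsConcat μ x y ↔ y = concat μ x := by
  constructor
  · rintro ⟨h1, h2⟩
    rw [← arrow_mk_toEnd] at h1
    exact eq_concat (Arrow.mk_injective _ _ h1) h2
  · rintro rfl
    refine ⟨?_, shift_concat _ _⟩
    rw [← arrow_mk_toEnd]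
    exact congrArg Arrow.mk (pre_concat μ x)

theorem concat_injective (μ : End (default : Λ)) :
    Function.Injective (concat μ : InfinitePath Λ → InfinitePath Λ) := fun x y h => by
  rw [← shift_concat μ x, h, shift_concat]

theorem eq_of_concat_eq {μ ν : End (default : Λ)} {x y : InfinitePath Λ}
    (h : concat μ x = concat ν y) (hd : deg μ = deg ν) : μ = ν := by
  rw [← pre_concat μ x, h, hd, pre_concat]

theorem concat_mul (μ ν : End (default : Λ)) (x : InfinitePath Λ) :
    concat (μ * ν) x = concat μ (concat ν x) :=
  pre_injective_of_le fun n => ⟨deg μ + deg ν + n, le_add_self, by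
    rw [← deg_mul, pre_concat_add, deg_mul, add_assoc, pre_concat_add, pre_concat_add, mul_assoc]⟩

theorem concat_comp (μ ν : (default : Λ) ⟶ default) (x : InfinitePath Λ) :
    concat (ν ≫ μ) x = concat μ (concat ν x) :=
  concat_mul μ ν x

theorem concat_one (x : InfinitePath Λ) : concat 1 x = x :=
  pre_injective fun n => by
    have := pre_concat_add 1 x n
    rwa [deg_one, zero_add, one_mul] at this

theorem shift_zero (x : InfinitePath Λ) : x.shift 0 = x := by
  have := shift_concat 1 x
  rwa [concat_one, deg_one] at this

theorem shift_shift (x : InfinitePath Λ) (m n : Fin k → ℕ) :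
    (x.shift m).shift n = x.shift (m + n) :=
  pre_injective fun l => by
    apply mul_left_cancel_path (μ := x.pre m * (x.shift m).pre n)
    rw [mul_assoc, pre_mul_pre_shift, pre_mul_pre_shift, pre_mul_pre_shift, pre_mul_pre_shift,
      add_assoc]

theorem shift_add_concat (μ : End (default : Λ)) (x : InfinitePath Λ) (n : Fin k → ℕ) :
    (concat μ x).shift (deg μ + n) = x.shift n := by
  rw [← shift_shift, shift_concat]

end InfinitePath

end PathMonoid

/-! ### Periods -/

section Periods

open InfinitePath

variable {k : ℕ} (Λ : Type u) [SmallCategory Λ] [KGraph k Λ] [Unique Λ]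

/-- `σ^n(x) = σ^m(x)` for all infinite paths `x`. -/
def ShiftEq (n m : Fin k → ℕ) : Prop := ∀ x : InfinitePath Λ, x.shift n = x.shift m

variable {Λ}

theorem ShiftEq.symm {k : ℕ} {Λ : Type u} [SmallCategory Λ] [KGraph k Λ] {n m : Fin k → ℕ} (h : ShiftEq Λ n m) : ShiftEq Λ m n := fun x => (h x).symm

/-- Every `x` is the tail of `lx`, and shifting by `deg l` commutes with shifting by `n` and `m`. -/
theorem ShiftEq.of_concat {n m : Fin k → ℕ} (l : End (default : Λ))
    (h : ∀ x : InfinitePath Λ, (concat l x).shift n = (concat l x).shift m) : ShiftEq Λ n m := by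
  intro x
  rw [← shift_add_concat l x n, ← shift_add_concat l x m, add_comm, add_comm _ m,
    ← shift_shift, h, shift_shift]

theorem ShiftEq.add {n m n' m' : Fin k → ℕ} (h : ShiftEq Λ n m) (h' : ShiftEq Λ n' m') :
    ShiftEq Λ (n + n') (m + m') := by
  intro x
  rw [← shift_shift, h x, h', shift_shift]

theorem exists_deg_eq (w : InfinitePath Λ) (n : Fin k → ℕ) : ∃ l : End (default : Λ), deg l = n :=
  ⟨w.pre n, w.deg_pre n⟩

theorem ShiftEq.of_add {n m p : Fin k → ℕ} (h : ShiftEq Λ (p + n) (p + m)) : ShiftEq Λ n m := by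
  intro x
  obtain ⟨l, hl⟩ := exists_deg_eq x p
  rw [← shift_add_concat l x n, ← shift_add_concat l x m, hl]
  exact h _

/-- Two distinct shifts already differ on a finite segment, so a long enough prefix certifies the
difference for all its continuations. -/
theorem exists_extension_separating {n m : Fin k → ℕ}
    (hnm : ¬ ShiftEq Λ n m) (l : End (default : Λ)) (D : Fin k → ℕ) :
    ∃ l' : End (default : Λ), l ∣ l' ∧ D ≤ deg l' ∧
      ∀ z : InfinitePath Λ, z.pre (deg l') = l' → z.shift n ≠ z.shift m := by
  obtain ⟨x, hx⟩ : ∃ x : InfinitePath Λ, (concat l x).shift n ≠ (concat l x).shift m := by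
    by_contra! hcon
    exact hnm (.of_concat l hcon)
  set y := concat l x with hy
  obtain ⟨p, hp⟩ : ∃ p, (y.shift n).pre p ≠ (y.shift m).pre p := by
    by_contra! hcon
    exact hx (pre_injective hcon)
  -- Large enough to extend `l`, to dominate `D`, and to contain both windows of length `p`,
  -- starting at `n` and at `m`.
  set N := deg l + D + (n + p) + (m + p) with hN
  have key : ∀ q r : Fin k → ℕ, q + r ≤ N → ∀ z : InfinitePath Λ, z.pre N = y.pre N →
      (z.shift q).pre r = (y.shift q).pre r := by
    intro q r hqr z hz
    have h1 : z.pre (q + r) = y.pre (q + r) :=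
      prefix_unique (z.pre_dvd hqr) (hz ▸ y.pre_dvd hqr) (by simp only [deg_pre])
    rw [← pre_mul_pre_shift, ← pre_mul_pre_shift] at h1
    exact (factor_unique h1 (by simp only [deg_pre])).2
  refine ⟨y.pre N, ?_, ?_, fun z hz hzz => hp ?_⟩
  · have h1 : y.pre (deg l) = l := pre_concat l x
    have h2 := y.pre_dvd (show deg l ≤ N by rw [hN, add_assoc, add_assoc]; exact le_self_add)
    rwa [h1] at h2
  · rw [deg_pre, hN]
    intro i
    simp only [Pi.add_apply]
    omega
  · rw [deg_pre] at hz
    rw [← key n p _ z hz, ← key m p _ z hz, hzz]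
    · exact le_add_self
    · rw [hN, add_right_comm]; exact le_add_self

theorem IsPeriodic.exists_shiftEq (w : InfinitePath Λ) (h : IsPeriodic Λ) :
    ∃ n m : Fin k → ℕ, n ≠ m ∧ ShiftEq Λ n m := by
  by_contra! hcon
  refine h fun v => ?_
  -- All pairs of degrees are enumerated; step `j` of the construction separates the `j`-th pair and
  -- makes every degree coordinate at least `j`.
  obtain ⟨e, he⟩ := exists_surjective_nat ((Fin k → ℕ) × (Fin k → ℕ))
  have step : ∀ (j : ℕ) (l : End (default : Λ)), ∃ l' : End (default : Λ), l ∣ l' ∧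
      (fun _ => j) ≤ deg l' ∧ ((e j).1 ≠ (e j).2 →
      ∀ z : InfinitePath Λ, z.pre (deg l') = l' → z.shift (e j).1 ≠ z.shift (e j).2) := by
    intro j l
    by_cases hj : (e j).1 = (e j).2
    · refine ⟨l * w.pre fun _ => j, dvd_mul_right _ _, ?_, fun h => absurd hj h⟩
      rw [deg_mul, deg_pre]
      exact le_add_self
    · obtain ⟨l', h1, h2, h3⟩ := exists_extension_separating (hcon _ _ hj) l fun _ => j
      exact ⟨l', h1, h2, fun _ => h3⟩
  choose g hg1 hg2 hg3 using step
  let f : ℕ → End (default : Λ) := fun j => Nat.rec 1 (fun j l => g j l) j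
  have hf : ∀ j, f (j + 1) = g j (f j) := fun _ => rfl
  have hmono : ∀ i j, i ≤ j → f i ∣ f j := by
    intro i j hij
    induction hij with
    | refl => exact dvd_refl _
    | step _ ih => exact ih.trans (hg1 _ _)
  obtain ⟨x, hx⟩ := exists_of_directed f
    (fun i j => ⟨max i j, hmono _ _ (le_max_left _ _), hmono _ _ (le_max_right _ _)⟩)
    -- The bound from step `j` holds for `f (j + 1)`, whence the `+ 1`.
    (fun n => ⟨Finset.univ.sup n + 1, by
      rw [hf]
      exact fun i => (Finset.le_sup (Finset.mem_univ i)).trans (hg2 _ _ i)⟩)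
  refine ⟨x, Subsingleton.elim _ _, fun n m hnm => ?_⟩
  obtain ⟨j, hj⟩ := he (n, m)
  have := hg3 j (f j) (by rwa [hj]) x (hx (j + 1))
  rwa [hj] at this

/-! ### Cycline pairs and the period group -/

theorem isCycline_iff {μ ν : (default : Λ) ⟶ default} :
    IsCycline μ ν ↔ ∀ x : InfinitePath Λ, concat μ x = concat ν x := by
  constructor
  · intro h x
    obtain ⟨y, h1, h2⟩ := h x (Subsingleton.elim _ _)
    rw [← isConcat_iff.1 h1, ← isConcat_iff.1 h2]
  · exact fun h x _ => ⟨concat μ x, isConcat_iff.2 rfl, isConcat_iff.2 (h x)⟩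

/-- Apply `σ^n` and `σ^m` to the single infinite path `μν'x = νμ'x`. -/
theorem ShiftEq.concat_eq {n m : Fin k → ℕ} (h : ShiftEq Λ n m) {μ ν μ' ν' : End (default : Λ)}
    (he : μ * ν' = ν * μ') (hμ : deg μ = n) (hν : deg ν = m) (x : InfinitePath Λ) :
    concat ν' x = concat μ' x := by
  have := h (concat (μ * ν') x)
  rw [concat_mul, ← hμ, shift_concat, ← concat_mul, he, concat_mul, ← hν, shift_concat] at this
  exact this

theorem shiftEq_of_concat_eq {μ ν : End (default : Λ)}
    (h : ∀ x : InfinitePath Λ, concat μ x = concat ν x) : ShiftEq Λ (deg μ) (deg ν) :=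
  .of_concat μ fun x => by rw [shift_concat, h, shift_concat]

theorem mem_Per_iff (w : InfinitePath Λ) {g : Fin k → ℤ} :
    g ∈ Per Λ ↔ ∃ n m : Fin k → ℕ, ShiftEq Λ n m ∧ g = fun i => (n i : ℤ) - (m i : ℤ) := by
  constructor
  · rintro ⟨v, v', v'', μ, ν, h, rfl⟩
    obtain rfl := Subsingleton.elim v default
    obtain rfl := Subsingleton.elim v' default
    obtain rfl := Subsingleton.elim v'' default
    exact ⟨_, _, shiftEq_of_concat_eq (isCycline_iff.1 h), rfl⟩
  · rintro ⟨n, m, h, rfl⟩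
    -- One path of degree `n + m` is factored in both orders; the two right-hand factors form the
    -- cycline pair.
    obtain ⟨μ, ν', hμ, hν', he⟩ := exists_factor (w.pre (n + m)) (deg_pre _ _)
    obtain ⟨ν, μ', hν, hμ', he'⟩ := exists_factor (w.pre (n + m)) ((deg_pre _ _).trans (add_comm _ _))
    refine ⟨default, default, default, μ', ν',
      isCycline_iff.2 fun x => (h.concat_eq (he.trans he'.symm) hμ hν x).symm, ?_⟩
    rw [hμ', hν']

/-- `Per(Λ)` as a subgroup of `ℤ^k`. -/
def perSubgroup (w : InfinitePath Λ) : AddSubgroup (Fin k → ℤ) where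
  carrier := Per Λ
  zero_mem' := (mem_Per_iff w).2 ⟨0, 0, fun _ => rfl, by ext; simp⟩
  add_mem' := by
    intro g g' hg hg'
    obtain ⟨n, m, h, rfl⟩ := (mem_Per_iff w).1 hg
    obtain ⟨n', m', h', rfl⟩ := (mem_Per_iff w).1 hg'
    refine (mem_Per_iff w).2 ⟨_, _, h.add h', ?_⟩
    ext i
    simp only [Pi.add_apply, Nat.cast_add]
    ring
  neg_mem' := by
    intro g hg
    obtain ⟨n, m, h, rfl⟩ := (mem_Per_iff w).1 hg
    refine (mem_Per_iff w).2 ⟨_, _, h.symm, ?_⟩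
    ext i
    simp only [Pi.neg_apply]
    ring

/-- Whether `σ^n = σ^m` depends only on `n - m`, since a common summand can be added and cancelled.
-/
theorem shiftEq_of_mem_Per (w : InfinitePath Λ) {n m : Fin k → ℕ}
    (h : (fun i => (n i : ℤ) - (m i : ℤ)) ∈ Per Λ) : ShiftEq Λ n m := by
  obtain ⟨n', m', h', he⟩ := (mem_Per_iff w).1 h
  have h2 : n' + m = m' + n := by
    ext i
    have := congrFun he i
    simp only [Pi.add_apply]
    omega
  have h3 : ShiftEq Λ (m' + n) (m' + m) := by
    rw [← h2]
    exact h'.add fun _ => rfl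
  exact h3.of_add

/-- A nonzero period `g ≥ 0` gives `σ^g x = x` for all `x`. This fails for an `x` made of two
different blocks of degree `g` in succession, and two edges of a degree occurring in `g` provide
such blocks. -/
theorem Per_nonneg_eq_zero (hedge : ∀ i : Fin k, ∃ μ ν : End (default : Λ), μ ≠ ν ∧
    deg μ = Pi.single i 1 ∧ deg ν = Pi.single i 1) (w : InfinitePath Λ) {g : Fin k → ℤ}
    (hg : g ∈ Per Λ) (h0 : ∀ i, 0 ≤ g i) : g = 0 := by
  by_contra hne
  obtain ⟨i, hi⟩ : ∃ i, g i ≠ 0 := by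
    by_contra! hcon
    exact hne (funext hcon)
  lift g to Fin k → ℕ using h0
  have hs : ShiftEq Λ g 0 := shiftEq_of_mem_Per w (by simpa using hg)
  obtain ⟨μ, ν, hμν, hμ, hν⟩ := hedge i
  obtain ⟨l, hl⟩ := exists_deg_eq w (g - Pi.single i 1)
  have hdeg : Pi.single i 1 + (g - Pi.single i 1) = g := by
    refine add_tsub_cancel_of_le fun j => ?_
    rcases eq_or_ne j i with rfl | hj
    · simp only [Pi.single_eq_same]
      simp only [ne_eq, Nat.cast_eq_zero] at hi
      omega
    · simp [hj]
  have hfix : ∀ x : InfinitePath Λ, x.shift g = x := fun x => by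
    rw [hs x]
    exact x.shift_zero
  have hμ' : deg (μ * l) = g := by rw [deg_mul, hμ, hl, hdeg]
  have hν' : deg (ν * l) = g := by rw [deg_mul, hν, hl, hdeg]
  have e1 := hfix (concat (μ * l) (concat (ν * l) w))
  rw [← hμ', shift_concat] at e1
  exact hμν (factor_unique (eq_of_concat_eq e1 (hν'.trans hμ'.symm)) (hν.trans hμ.symm)).1.symm

theorem Per_eq_zero_of_apply_eq_zero {Λ : Type u} [SmallCategory Λ] [KGraph 2 Λ] [Unique Λ]
    (hedge : ∀ i : Fin 2, ∃ μ ν : End (default : Λ), μ ≠ ν ∧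
    deg μ = Pi.single i 1 ∧ deg ν = Pi.single i 1) (w : InfinitePath Λ) {g : Fin 2 → ℤ}
    (hg : g ∈ Per Λ) (h0 : g 0 = 0) : g = 0 := by
  rcases le_total 0 (g 1) with h1 | h1
  · exact Per_nonneg_eq_zero hedge w hg (Fin.forall_fin_two.2 ⟨h0.ge, h1⟩)
  · refine neg_eq_zero.1 (Per_nonneg_eq_zero hedge w ((perSubgroup w).neg_mem hg)
      (Fin.forall_fin_two.2 ⟨?_, ?_⟩))
    · simp [h0]
    · simpa using h1

theorem exists_Per_eq_multiples {Λ : Type u} [SmallCategory Λ] [KGraph 2 Λ] [Unique Λ]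
    (hedge : ∀ i : Fin 2, ∃ μ ν : End (default : Λ), μ ≠ ν ∧
    deg μ = Pi.single i 1 ∧ deg ν = Pi.single i 1) (w : InfinitePath Λ) (hper : IsPeriodic Λ) :
    ∃ a b : ℕ, 0 < a ∧ 0 < b ∧ Per Λ = {g | ∃ n : ℤ, g = n • ![(a : ℤ), -(b : ℤ)]} := by
  have hmem : ∀ g, g ∈ perSubgroup w ↔ g ∈ Per Λ := fun _ => Iff.rfl
  -- The projection of `Per Λ` to the first coordinate is a subgroup of `ℤ`; a preimage of its
  -- generator, up to sign, will generate `Per Λ`.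
  obtain ⟨c, hc⟩ := Int.subgroup_cyclic
    ((perSubgroup w).map (Pi.evalAddMonoidHom (fun _ : Fin 2 => ℤ) 0))
  have hcmem : ∃ g ∈ Per Λ, g 0 = c := by
    have : c ∈ (perSubgroup w).map (Pi.evalAddMonoidHom (fun _ : Fin 2 => ℤ) 0) := by
      rw [hc]; exact AddSubgroup.subset_closure rfl
    obtain ⟨g, hg, h⟩ := this
    exact ⟨g, hg, h⟩
  have hgen : ∀ g ∈ Per Λ, ∃ n : ℤ, g 0 = n * c := by
    intro g hg
    have : g 0 ∈ (perSubgroup w).map (Pi.evalAddMonoidHom (fun _ : Fin 2 => ℤ) 0) := ⟨g, hg, rfl⟩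
    rw [hc, AddSubgroup.mem_closure_singleton] at this
    obtain ⟨n, hn⟩ := this
    exact ⟨n, by rw [← hn, smul_eq_mul]⟩
  have hc0 : c ≠ 0 := by
    rintro rfl
    obtain ⟨n, m, hnm, h⟩ := hper.exists_shiftEq w
    have hg := (mem_Per_iff w).2 ⟨n, m, h, rfl⟩
    obtain ⟨q, hq⟩ := hgen _ hg
    have := Per_eq_zero_of_apply_eq_zero hedge w hg (by rw [hq, mul_zero])
    refine hnm (funext fun i => ?_)
    have := congrFun this i
    simp only [Pi.zero_apply] at this
    omega
  obtain ⟨g, hg, hgpos, hgen⟩ : ∃ g ∈ Per Λ, 0 < g 0 ∧ ∀ g' ∈ Per Λ, ∃ n : ℤ, g' 0 = n * g 0 := by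
    obtain ⟨g, hg, rfl⟩ := hcmem
    rcases hc0.lt_or_gt with h | h
    · refine ⟨-g, (perSubgroup w).neg_mem hg, neg_pos.2 h, fun g' hg' => ?_⟩
      obtain ⟨n, hn⟩ := hgen g' hg'
      exact ⟨-n, by rw [hn, Pi.neg_apply, neg_mul_neg]⟩
    · exact ⟨g, hg, h, hgen⟩
  have hneg : g 1 < 0 := by
    by_contra! hcon
    have := Per_nonneg_eq_zero hedge w hg (Fin.forall_fin_two.2 ⟨hgpos.le, hcon⟩)
    rw [this] at hgpos
    exact lt_irrefl _ hgpos
  have hgab : g = ![((g 0).toNat : ℤ), -((-g 1).toNat : ℤ)] := by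
    ext i
    fin_cases i
    · simp [hgpos.le]
    · simp [hneg.le]
  refine ⟨(g 0).toNat, (-g 1).toNat, by omega, by omega, ?_⟩
  rw [← hgab]
  ext g'
  constructor
  · intro hg'
    obtain ⟨n, hn⟩ := hgen g' hg'
    refine ⟨n, sub_eq_zero.1 (Per_eq_zero_of_apply_eq_zero hedge w
      ((perSubgroup w).sub_mem hg' ((perSubgroup w).zsmul_mem hg n)) ?_)⟩
    simp [hn]
  · rintro ⟨n, rfl⟩
    exact (perSubgroup w).zsmul_mem hg n

/-- Put any `κ` of degree `m` in front of `μ` and refactor `κμ = μ'ν'` with `μ'` of degree `n`; then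
`ν'` acts as `μ`. Uniqueness holds because the prefix of degree `m` determines the path. -/
theorem ShiftEq.existsUnique_concat_eq (w : InfinitePath Λ) {n m : Fin k → ℕ}
    (h : ShiftEq Λ n m) (μ : PathsOfDegree Λ n) :
    ∃! ν : PathsOfDegree Λ m, ∀ x : InfinitePath Λ, concat μ.1 x = concat ν.1 x := by
  obtain ⟨κ, hκ⟩ := exists_deg_eq w m
  obtain ⟨μ', ν', hμ', hν', he⟩ := exists_factor (μ.1 ≫ κ) (n := n) (m := m)
    (by rw [deg_comp, hκ, μ.2, add_comm])
  have he : μ' * ν' = (κ * toEnd μ.1 : End (default : Λ)) := by rw [toEnd_eq]; exact he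
  have key := fun x => h.concat_eq he hμ' hκ x
  simp only [toEnd_eq] at key
  refine ⟨⟨ν', hν'⟩, fun x => (key x).symm, fun ν'' h'' => Subtype.ext ?_⟩
  exact eq_of_concat_eq ((h'' w).symm.trans (key w).symm) (ν''.2.trans hν'.symm)

theorem ShiftEq.exists_equiv (w : InfinitePath Λ) {n m : Fin k → ℕ} (h : ShiftEq Λ n m) :
    ∃ e : PathsOfDegree Λ n ≃ PathsOfDegree Λ m,
      ∀ μ (x : InfinitePath Λ), concat μ.1 x = concat (e μ).1 x := by
  choose f hf hf' using h.existsUnique_concat_eq w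
  choose g hg hg' using h.symm.existsUnique_concat_eq w
  refine ⟨⟨f, g, fun μ => ?_, fun ν => ?_⟩, hf⟩
  · exact (hg' _ _ fun x => (hf μ x).symm).symm
  · exact (hf' _ _ fun x => (hg ν x).symm).symm

theorem exists_isPeriodData {Λ : Type u} [SmallCategory Λ] [KGraph 2 Λ] [Unique Λ]
    (hedge : ∀ i : Fin 2, ∃ μ ν : End (default : Λ), μ ≠ ν ∧
    deg μ = Pi.single i 1 ∧ deg ν = Pi.single i 1) (w : InfinitePath Λ) (hper : IsPeriodic Λ) :
    ∃ (a b : ℕ) (h : PathsOfDegree Λ ![a, 0] ≃ PathsOfDegree Λ ![0, b]), IsPeriodData a b h := by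
  obtain ⟨a, b, ha, hb, hPer⟩ := exists_Per_eq_multiples hedge w hper
  have hs : ShiftEq Λ ![a, 0] ![0, b] := shiftEq_of_mem_Per w <| by
    rw [hPer]
    refine ⟨1, ?_⟩
    ext i
    fin_cases i <;> simp
  obtain ⟨e, he⟩ := hs.exists_equiv w
  refine ⟨a, b, e, ha, hb, hPer, fun μ ν => ?_⟩
  have hν : concat ν.1 w = concat (e.symm ν).1 w := by rw [he, e.apply_symm_apply]
  -- Both products have degree `(a, b)`, so it suffices that they agree in front of one infinite
  -- path.
  refine eq_of_concat_eq (μ := ν.1 ≫ μ.1) (ν := (e.symm ν).1 ≫ (e μ).1) (x := w) (y := w) ?_ ?_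
  · rw [concat_comp, concat_comp, hν, he]
  · rw [deg_comp, deg_comp, μ.2, ν.2, (e μ).2, (e.symm ν).2, add_comm]

end Periods

end KGraph

/-! ### Composition operators on `ℓ²` -/

namespace lp

open scoped InnerProductSpace

variable {X : Type*} {φ : X → X}

/-- For an injective `φ : X → X`, the operator `f ↦ f ∘ φ` on `ℓ²(X)`. -/
noncomputable def compInjective (hφ : φ.Injective) :
    lp (fun _ : X => ℂ) 2 →L[ℂ] lp (fun _ : X => ℂ) 2 :=
  have h2 : 0 < (2 : ENNReal).toReal := by norm_num
  LinearMap.mkContinuous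
    { toFun := fun f => ⟨fun x => f (φ x),
        memℓp_gen (((lp.memℓp f).summable h2).comp_injective hφ)⟩
      map_add' := fun _ _ => rfl
      map_smul' := fun _ _ => rfl } 1 fun f => by
    rw [one_mul]
    refine lp.norm_le_of_tsum_le h2 (norm_nonneg f) ?_
    rw [lp.norm_rpow_eq_tsum h2]
    exact tsum_comp_le_tsum_of_inj ((lp.memℓp f).summable h2)
      (fun _ => Real.rpow_nonneg (norm_nonneg _) _) hφ

theorem compInjective_apply (hφ : φ.Injective) (f : lp (fun _ : X => ℂ) 2) (x : X) :
    compInjective hφ f x = f (φ x) := rfl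

/-- The point mass at `x`. -/
noncomputable def delta (x : X) : lp (fun _ : X => ℂ) 2 :=
  have := Classical.decEq X
  lp.single 2 x 1

theorem delta_apply_self (x : X) : delta x x = 1 := by
  classical
  rw [delta, lp.single_apply_self]

theorem delta_apply_ne {x y : X} (h : y ≠ x) : delta x y = 0 := by
  classical
  rw [delta, lp.single_apply_ne _ _ _ h]

theorem inner_delta (x : X) (f : lp (fun _ : X => ℂ) 2) : ⟪delta x, f⟫_ℂ = f x := by
  classical
  rw [delta, lp.inner_single_left]
  simp

/-- The coefficient of `A^* f` at `x` is `⟪A δ_x, f⟫`, so the values on point masses determine the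
adjoint. -/
theorem clm_ext {A B : lp (fun _ : X => ℂ) 2 →L[ℂ] lp (fun _ : X => ℂ) 2}
    (h : ∀ x, A (delta x) = B (delta x)) : A = B := by
  refine star_injective (ContinuousLinearMap.ext fun f => lp.ext (funext fun x => ?_))
  rw [← inner_delta, ← inner_delta, ContinuousLinearMap.star_eq_adjoint,
    ContinuousLinearMap.star_eq_adjoint, ContinuousLinearMap.adjoint_inner_right,
    ContinuousLinearMap.adjoint_inner_right, h]

theorem star_compInjective_delta (hφ : φ.Injective) (x : X) :
    star (compInjective hφ) (delta x) = delta (φ x) := by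
  refine ext_inner_right ℂ fun f => ?_
  rw [ContinuousLinearMap.star_eq_adjoint, ContinuousLinearMap.adjoint_inner_left, inner_delta,
    inner_delta, compInjective_apply]

theorem compInjective_delta (hφ : φ.Injective) (x : X) :
    compInjective hφ (delta (φ x)) = delta x := by
  refine lp.ext (funext fun y => ?_)
  rw [compInjective_apply]
  rcases eq_or_ne y x with rfl | h
  · rw [delta_apply_self, delta_apply_self]
  · rw [delta_apply_ne h, delta_apply_ne (hφ.ne h)]

theorem compInjective_delta_of_notMem (hφ : φ.Injective) {x : X} (hx : x ∉ Set.range φ) :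
    compInjective hφ (delta x) = 0 := by
  refine lp.ext (funext fun y => ?_)
  rw [compInjective_apply, delta_apply_ne]
  · rfl
  · rintro rfl
    exact hx ⟨y, rfl⟩

end lp

namespace KGraph

/-! ### Twisted representations on the space of infinite paths -/

section Representation

open InfinitePath

variable {k : ℕ} {Λ : Type u} [SmallCategory Λ] [KGraph k Λ] [Unique Λ]

/-- The isometry `δ_x ↦ δ_{μx}` of `ℓ²(Λ^∞)`. -/
noncomputable def pathIsometry (μ : End (default : Λ)) :
    lp (fun _ : InfinitePath Λ => ℂ) 2 →L[ℂ] lp (fun _ : InfinitePath Λ => ℂ) 2 :=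
  star (lp.compInjective (concat_injective μ))

theorem pathIsometry_delta (μ : End (default : Λ)) (x : InfinitePath Λ) :
    pathIsometry μ (lp.delta x) = lp.delta (concat μ x) :=
  lp.star_compInjective_delta _ x

theorem star_pathIsometry_delta (μ : End (default : Λ)) (x : InfinitePath Λ) :
    star (pathIsometry μ) (lp.delta (concat μ x)) = lp.delta x := by
  rw [pathIsometry, star_star, lp.compInjective_delta]

theorem star_pathIsometry_delta_of_ne {μ : End (default : Λ)} {x : InfinitePath Λ}
    (h : x.pre (deg μ) ≠ μ) : star (pathIsometry μ) (lp.delta x) = 0 := by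
  rw [pathIsometry, star_star, lp.compInjective_delta_of_notMem]
  rintro ⟨y, rfl⟩
  exact h (pre_concat μ y)

theorem pathIsometry_one : pathIsometry (1 : End (default : Λ)) = 1 :=
  lp.clm_ext fun x => by rw [pathIsometry_delta, concat_one]; rfl

theorem pathIsometry_mul (μ ν : End (default : Λ)) :
    pathIsometry (μ * ν) = pathIsometry μ * pathIsometry ν :=
  lp.clm_ext fun x => by
    rw [mul_apply_eq_comp, pathIsometry_delta, pathIsometry_delta, pathIsometry_delta,
      concat_mul]

theorem star_pathIsometry_mul_self (μ : End (default : Λ)) :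
    star (pathIsometry μ) * pathIsometry μ = 1 :=
  lp.clm_ext fun x => by
    rw [mul_apply_eq_comp, pathIsometry_delta, star_pathIsometry_delta]; rfl

theorem sum_pathIsometry_mul_star [RowFinite Λ] (v : Λ) (n : Fin k → ℕ) :
    ∑ p : PathsTo v n, pathIsometry (toEnd p.1.2) * star (pathIsometry (toEnd p.1.2)) = 1 := by
  obtain rfl := Subsingleton.elim v default
  refine lp.clm_ext fun x => ?_
  rw [sum_apply]
  -- Only the summand of the prefix of `x` of degree `n` acts nontrivially on `δ_x`, and it fixes
  -- it.
  rw [Finset.sum_eq_single ⟨⟨default, x.pre n⟩, x.deg_pre n⟩]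
  · dsimp only
    rw [mul_apply_eq_comp, toEnd_eq]
    have h := star_pathIsometry_delta (x.pre n) (x.shift n)
    rw [concat_pre_shift] at h
    rw [h, pathIsometry_delta, concat_pre_shift]
    rfl
  · rintro ⟨⟨w, μ⟩, hμ⟩ - hne
    obtain rfl := Subsingleton.elim w default
    rw [mul_apply_eq_comp, star_pathIsometry_delta_of_ne, map_zero]
    intro h
    dsimp only at h hμ
    rw [toEnd_eq, hμ] at h
    refine hne (Subtype.ext ?_)
    simp only [h]
  · exact fun h => absurd (Finset.mem_univ _) h

/-- The representation of `Λ` on `ℓ²(Λ^∞)`, twisted by the character `n ↦ t ^ (n i)` of `ℤ^k`. -/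
noncomputable def twistedFamily (i : Fin k) (t : ℂ) ⦃v w : Λ⦄ (μ : v ⟶ w) :
    lp (fun _ : InfinitePath Λ => ℂ) 2 →L[ℂ] lp (fun _ : InfinitePath Λ => ℂ) 2 :=
  t ^ (deg μ i) • pathIsometry (toEnd μ)

theorem twistedFamily_id (i : Fin k) (t : ℂ) (v : Λ) : twistedFamily i t (𝟙 v) = 1 := by
  obtain rfl := Subsingleton.elim v default
  rw [twistedFamily, deg_id, toEnd_eq, Pi.zero_apply, pow_zero, one_smul]
  exact pathIsometry_one

theorem isCKFamily_twistedFamily [RowFinite Λ] (i : Fin k) {t : ℂ} (ht : star t * t = 1) :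
    IsCKFamily (twistedFamily (Λ := Λ) i t) where
  isStarProjection v := by rw [twistedFamily_id]; exact .one _
  orthogonal v w h := absurd (Subsingleton.elim v w) h
  map_comp μ ν := by
    simp only [twistedFamily]
    rw [deg_comp, toEnd_comp, pathIsometry_mul, Pi.add_apply, pow_add, smul_mul_smul_comm]
  star_mul_self μ := by
    rw [twistedFamily_id, twistedFamily, star_smul, smul_mul_smul_comm, star_pathIsometry_mul_self,
      star_pow, ← mul_pow, ht, one_pow, one_smul]
  sum_mul_star v n := by
    rw [twistedFamily_id, ← sum_pathIsometry_mul_star v n]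
    refine Finset.sum_congr rfl fun p _ => ?_
    rw [twistedFamily, star_smul, smul_mul_smul_comm, star_pow, ← mul_pow, mul_comm t, ht, one_pow,
      one_smul]

theorem exists_algHom [RowFinite Λ] (i : Fin k) {t : ℂ} (ht : star t * t = 1) :
    ∃ Φ : GraphCStar Λ →⋆ₐ[ℂ]
      (lp (fun _ : InfinitePath Λ => ℂ) 2 →L[ℂ] lp (fun _ : InfinitePath Λ => ℂ) 2),
      ∀ {v w : Λ} (μ : v ⟶ w), Φ (gen μ) = twistedFamily i t μ := by
  obtain ⟨φ, hφ, -⟩ := existsUnique_hom _ (isCKFamily_twistedFamily (Λ := Λ) i ht)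
  have h1 : φ 1 = 1 := (hφ (𝟙 default)).trans (twistedFamily_id i t default)
  exact ⟨{ φ with
    map_one' := h1
    commutes' := fun c => by
      change φ (algebraMap ℂ _ c) = _
      rw [Algebra.algebraMap_eq_smul_one, Algebra.algebraMap_eq_smul_one, map_smul, h1] }, hφ⟩

end Representation

/-! ### The distinguished unitary -/

/-- Compressing `∑ s_l s_l^* = 1` by `s_j` writes `1` as a sum of positive elements whose `j`-th
term is already `1`, so all the others vanish. -/
theorem star_mul_eq_zero_of_sum_mul_star {A ι : Type*} [CStarAlgebra A] [Fintype ι] {s : ι → A}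
    (hs : ∀ i, star (s i) * s i = 1) (hsum : ∑ i, s i * star (s i) = 1) {i j : ι} (hij : i ≠ j) :
    star (s i) * s j = 0 := by
  classical
  let _ := CStarAlgebra.spectralOrder A
  have _ := CStarAlgebra.spectralOrderedRing A
  have h1 : ∑ l, star (star (s l) * s j) * (star (s l) * s j) = 1 := by
    have : star (s j) * (∑ l, s l * star (s l)) * s j = 1 := by rw [hsum, mul_one, hs]
    rw [← this, Finset.mul_sum, Finset.sum_mul]
    exact Finset.sum_congr rfl fun l _ => by simp only [star_mul, star_star, mul_assoc]
  rw [← Finset.add_sum_erase _ _ (Finset.mem_univ j), hs, star_one, mul_one, add_eq_left,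
    Finset.sum_eq_zero_iff_of_nonneg fun _ _ => star_mul_self_nonneg _] at h1
  exact (CStarRing.star_mul_self_eq_zero_iff _).1
    (h1 i (Finset.mem_erase.2 ⟨hij, Finset.mem_univ i⟩))

theorem sum_mul_star_mem_unitary {A ι : Type*} [CStarAlgebra A] [Fintype ι] {s t : ι → A}
    (hs : ∀ i, star (s i) * s i = 1) (hs' : ∑ i, s i * star (s i) = 1)
    (ht : ∀ i, star (t i) * t i = 1) (ht' : ∑ i, t i * star (t i) = 1) :
    ∑ i, t i * star (s i) ∈ unitary A := by
  have key : ∀ s t : ι → A, (∑ i, s i * star (s i) = 1) → (∀ i, star (t i) * t i = 1) →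
      (∑ i, t i * star (t i) = 1) →
      star (∑ i, t i * star (s i)) * ∑ i, t i * star (s i) = 1 := by
    intro s t hs' ht ht'
    rw [star_sum, Finset.sum_mul, ← hs']
    refine Finset.sum_congr rfl fun i _ => ?_
    rw [Finset.mul_sum, Finset.sum_eq_single i]
    · rw [star_mul, star_star, mul_assoc, ← mul_assoc (star (t i)), ht, one_mul]
    · intro j _ hji
      rw [star_mul, star_star, mul_assoc, ← mul_assoc (star (t i)),
        star_mul_eq_zero_of_sum_mul_star ht ht' hji.symm, zero_mul, mul_zero]
    · exact fun h => absurd (Finset.mem_univ _) h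
  refine Unitary.mem_iff.2 ⟨key s t hs' ht ht', ?_⟩
  -- Exchanging the two families turns the sum into its adjoint, which gives the other unitarity
  -- relation.
  have h := key t s ht' hs hs'
  have h2 : star (∑ i, s i * star (t i)) = ∑ i, t i * star (s i) := by simp
  rwa [h2, ← star_star (∑ i, s i * star (t i)), h2] at h

theorem exists_starAlgEquiv_circle {A : Type*} [CStarAlgebra A] {W : A} (hW : W ∈ unitary A)
    (hspec : Metric.sphere (0 : ℂ) 1 ⊆ spectrum ℂ W) :
    ∃ φ : StarAlgebra.elemental ℂ W ≃⋆ₐ[ℂ] C(Circle, ℂ),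
      φ ⟨W, StarAlgebra.elemental.self_mem ℂ _⟩ =
        ⟨fun z : Circle => (z : ℂ), continuous_subtype_val⟩ := by
  have : IsStarNormal W := ⟨(Unitary.mem_iff.1 hW).1.trans (Unitary.mem_iff.1 hW).2.symm⟩
  have heq : spectrum ℂ W = Metric.sphere (0 : ℂ) 1 :=
    (spectrum.subset_circle_of_unitary hW).antisymm hspec
  let e : Circle ≃ₜ spectrum ℂ W := Homeomorph.setCongr heq.symm
  refine ⟨(continuousFunctionalCalculus W).symm.trans (e.compStarAlgEquiv' ℂ ℂ), ?_⟩
  rw [← continuousFunctionalCalculus_map_id, StarAlgEquiv.trans_apply,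
    StarAlgEquiv.symm_apply_apply]
  rfl

section SingleVertex

variable {k : ℕ} {Λ : Type u} [SmallCategory Λ] [KGraph k Λ] [Unique Λ] [RowFinite Λ]

theorem star_gen_mul_self (μ : (default : Λ) ⟶ default) : star (gen μ) * gen μ = 1 :=
  gen_isCKFamily.star_mul_self μ

theorem sum_gen_mul_star_gen (n : Fin k → ℕ) :
    ∑ μ : PathsOfDegree Λ n, gen μ.1 * star (gen μ.1) = 1 := by
  refine Eq.trans ?_ (gen_isCKFamily.sum_mul_star (default : Λ) n).symm
  refine Fintype.sum_bijective
    (fun μ => (⟨⟨default, μ.1⟩, μ.2⟩ : PathsTo (default : Λ) n)) ⟨fun μ ν h => ?_, ?_⟩ _ _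
    fun _ => rfl
  · have := congrArg Subtype.val h
    simp only [Sigma.mk.injEq, heq_eq_eq, true_and] at this
    exact Subtype.ext this
  · rintro ⟨⟨w, μ⟩, hμ⟩
    obtain rfl := Subsingleton.elim w default
    exact ⟨⟨μ, hμ⟩, rfl⟩

end SingleVertex

section DistinguishedUnitary

variable {Λ : Type u} [SmallCategory Λ] [KGraph 2 Λ] [Unique Λ] [RowFinite Λ] {a b : ℕ}

theorem distinguishedW_mem_unitary (h : PathsOfDegree Λ ![a, 0] ≃ PathsOfDegree Λ ![0, b]) :
    distinguishedW h ∈ unitary (GraphCStar Λ) :=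
  sum_mul_star_mem_unitary (fun μ => star_gen_mul_self μ.1) (sum_gen_mul_star_gen _)
    (fun μ => star_gen_mul_self (h μ).1)
    ((Equiv.sum_comp h fun ν => gen ν.1 * star (gen ν.1)).trans (sum_gen_mul_star_gen _))

/-- The first degree coordinate is `a` on `μ` and `0` on `h μ`, so the twist by `t` multiplies the
image of `W` by `star t ^ a`. Homomorphisms shrink spectra, so the spectrum of `W` contains all
these rotations. -/
theorem sphere_subset_spectrum_distinguishedW (w : InfinitePath Λ) (ha : 0 < a)
    (h : PathsOfDegree Λ ![a, 0] ≃ PathsOfDegree Λ ![0, b]) :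
    Metric.sphere (0 : ℂ) 1 ⊆ spectrum ℂ (distinguishedW h) := by
  have hrot : ∀ {t : ℂ}, star t * t = 1 → ∀ z ∈ spectrum ℂ (star t ^ a •
      ∑ μ : PathsOfDegree Λ ![a, 0], pathIsometry (h μ).1 * star (pathIsometry μ.1)),
      z ∈ spectrum ℂ (distinguishedW h) := by
    intro t ht z hz
    obtain ⟨Φ, hΦ⟩ := exists_algHom (Λ := Λ) 0 ht
    refine AlgHom.spectrum_apply_subset Φ _ ?_
    convert hz
    rw [distinguishedW, map_sum, Finset.smul_sum]
    refine Finset.sum_congr rfl fun μ _ => ?_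
    rw [map_mul, map_star, hΦ, hΦ, twistedFamily, twistedFamily, μ.2, (h μ).2, toEnd_eq, toEnd_eq]
    simp
  have : Nontrivial (lp (fun _ : InfinitePath Λ => ℂ) 2) :=
    ⟨lp.delta w, 0, fun h0 => one_ne_zero (α := ℂ) <| by
      rw [← lp.delta_apply_self w, h0]; rfl⟩
  intro z hz
  obtain ⟨l, hl⟩ := spectrum.nonempty
    (∑ μ : PathsOfDegree Λ ![a, 0], pathIsometry (h μ).1 * star (pathIsometry μ.1))
  -- The untwisted case `t = 1` puts `l` in the spectrum of the unitary `W`.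
  have hl1 : ‖l‖ = 1 := by
    have := spectrum.subset_circle_of_unitary (distinguishedW_mem_unitary h)
      (hrot (t := 1) (by simp) l (by simpa using hl))
    simpa using this
  have hz1 : ‖z‖ = 1 := by simpa using hz
  -- An `a`-th root of the rotation carrying `l` to `z`; the twist is then by `star s`.
  obtain ⟨s, hs⟩ := IsAlgClosed.exists_pow_nat_eq (z / l) ha
  have hs1 : ‖s‖ = 1 := by
    refine (pow_eq_one_iff_of_nonneg (norm_nonneg s) ha.ne').1 ?_
    rw [← norm_pow, hs, norm_div, hl1, hz1, div_one]
  have hss : star s * s = 1 := by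
    rw [Complex.star_def, ← Complex.normSq_eq_conj_mul_self, Complex.normSq_eq_norm_sq, hs1]
    simp
  have hl0 : l ≠ 0 := norm_ne_zero_iff.1 (by rw [hl1]; exact one_ne_zero)
  have hs0 : s ≠ 0 := norm_ne_zero_iff.1 (by rw [hs1]; exact one_ne_zero)
  refine hrot (t := star s) (by rw [star_star, mul_comm, hss]) z ?_
  rw [star_star]
  have hzs : z = s ^ a • l := by rw [hs, smul_eq_mul, div_mul_cancel₀ _ hl0]
  rw [hzs]
  exact (spectrum.smul_mem_smul_iff (r := Units.mk0 (s ^ a) (pow_ne_zero _ hs0))).2 hl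

end DistinguishedUnitary

/-! ### An infinite path and distinct edges from the cardinality hypotheses -/

theorem nonempty_infinitePath {Λ : Type u} [SmallCategory Λ] [KGraph 2 Λ] [Unique Λ]
    {e f : End (default : Λ)} (he : deg e = ![1, 0]) (hf : deg f = ![0, 1]) :
    Nonempty (InfinitePath Λ) := by
  have hdeg : ∀ j : ℕ, deg ((e * f) ^ j : End (default : Λ)) = fun _ => j := by
    intro j
    induction j with
    | zero => rw [pow_zero, deg_one]; rfl
    | succ j ih =>
      rw [pow_succ, deg_mul, ih, deg_mul, he, hf]
      ext i
      fin_cases i <;> simp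
  -- The powers of `ef` have degrees `(j, j)`, which are cofinal.
  obtain ⟨x, -⟩ := InfinitePath.exists_of_directed (fun j : ℕ => (e * f) ^ j)
    (fun i j => ⟨max i j, pow_dvd_pow _ (le_max_left _ _), pow_dvd_pow _ (le_max_right _ _)⟩)
    (fun n => ⟨Finset.univ.sup n, by
      rw [hdeg]
      exact fun i => Finset.le_sup (Finset.mem_univ i)⟩)
  exact ⟨x⟩

theorem exists_ne_of_two_le_card {k : ℕ} {Λ : Type u} [SmallCategory Λ] [KGraph k Λ] [Unique Λ]
    {n : Fin k → ℕ} (h : 2 ≤ Nat.card (PathsOfDegree Λ n)) :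
    ∃ μ ν : End (default : Λ), μ ≠ ν ∧ deg μ = n ∧ deg ν = n := by
  have : Finite (PathsOfDegree Λ n) := Nat.finite_of_card_ne_zero (by omega)
  obtain ⟨μ, ν, hne⟩ := (Finite.one_lt_card_iff_nontrivial.1 h).exists_pair_ne
  exact ⟨μ.1, ν.1, fun h => hne (Subtype.ext h), μ.2, ν.2⟩

end KGraph

theorem mainTheorem6 {Λ : Type u} [SmallCategory Λ] [KGraph 2 Λ] [Unique Λ]
    [KGraph.RowFinite Λ]
    (h₁ : 2 ≤ Nat.card (KGraph.PathsOfDegree Λ ![1, 0]))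
    (h₂ : 2 ≤ Nat.card (KGraph.PathsOfDegree Λ ![0, 1]))
    (hper : KGraph.IsPeriodic Λ) :
    (∃ (a b : ℕ) (h : KGraph.PathsOfDegree Λ ![a, 0] ≃ KGraph.PathsOfDegree Λ ![0, b]),
      KGraph.IsPeriodData a b h) ∧
    ∀ (a b : ℕ) (h : KGraph.PathsOfDegree Λ ![a, 0] ≃ KGraph.PathsOfDegree Λ ![0, b]),
      KGraph.IsPeriodData a b h →
      KGraph.distinguishedW h ∈ unitary (KGraph.GraphCStar Λ) ∧
      Metric.sphere (0 : ℂ) 1 ⊆ spectrum ℂ (KGraph.distinguishedW h) ∧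
      ∃ φ : StarAlgebra.elemental ℂ (KGraph.distinguishedW h) ≃⋆ₐ[ℂ] C(Circle, ℂ),
        φ ⟨KGraph.distinguishedW h, StarAlgebra.elemental.self_mem ℂ _⟩ =
          ⟨fun z : Circle => (z : ℂ), continuous_subtype_val⟩ := by
  obtain ⟨e, e', he, hde, hde'⟩ := KGraph.exists_ne_of_two_le_card h₁
  obtain ⟨f, f', hf, hdf, hdf'⟩ := KGraph.exists_ne_of_two_le_card h₂
  obtain ⟨w⟩ := KGraph.nonempty_infinitePath hde hdf
  have e0 : ![1, 0] = (Pi.single 0 1 : Fin 2 → ℕ) := by ext i; fin_cases i <;> rfl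
  have e1 : ![0, 1] = (Pi.single 1 1 : Fin 2 → ℕ) := by ext i; fin_cases i <;> rfl
  rw [e0] at hde hde'
  rw [e1] at hdf hdf'
  refine ⟨KGraph.exists_isPeriodData (Fin.forall_fin_two.2
    ⟨⟨e, e', he, hde, hde'⟩, ⟨f, f', hf, hdf, hdf'⟩⟩) w hper, fun a b h hd => ?_⟩
  have hspec := KGraph.sphere_subset_spectrum_distinguishedW w hd.pos_left h
  have hW := KGraph.distinguishedW_mem_unitary h
  exact ⟨hW, hspec, KGraph.exists_starAlgEquiv_circle hW hspec⟩
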